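/- Conventions. Graphs are simple. In a connected graph $X$ with path metric $d$, a clique is a maximal complete subgraph; a set $Y$ of vertices is gated if every vertex $x$ has a gate in $Y$, i.e. a vertex $\mathrm{proj}_Y(x)\in Y$ (necessarily unique) such that for every $y\in Y$ some geodesic from $x$ to $y$ passes through it. $X$ is clique-gated if it is connected and all its cliques are gated; two cliques $C,D$ are parallel if $\mathrm{proj}_D$ induces a bijection $C\to D$; $X$ is paraclique if it is clique-gated and parallelism of cliques is transitive. A hyperplane $J$ is the set of all edges of the cliques in a parallelism class; the sectors delimited by $J$ are the connected components of the graph obtained from $X$ by removing the edges in $J$. Two hyperplanes are transverse if every sector delimited by the first meets every sector delimited by the second. $J$ separates $H$ and $K$ if $H$ and $K$ lie in distinct sectors delimited by $J$. A facing triple consists of three distinct, pairwise non-transverse hyperplanes such that none separates the other two. A system of metrics $\mathscr C=\{(C,\delta_C)\}$ is the data of a metric $\delta_C$ on every clique $C$ of $X$. Its extended metric is $$\delta(x,y)=\inf\sum_{i=0}^{n-1}\delta_{C_i}(v_i,v_{i+1}),$$ the infimum over all finite sequences of vertices $v_0=x,v_1,\dots,v_n=y$ and cliques $C_0,\dots,C_{n-1}$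 with $v_i,v_{i+1}\in C_i$. The system is coherent if for all parallel cliques $C,D$ the projection $(C,\delta_C)\to(D,\delta_D)$ is an isometry; it is $G$-invariant, for a group $G$ acting on $X$, if $\delta_{gC}(gx,gy)=\delta_C(x,y)$ for all $g\in G$, all cliques $C$ and all $x,y\in C$. For a coherent system, $\mathrm{thick}(J)\in[0,\infty]$ is the diameter of $(C,\delta_C)$ for any clique $C$ whose edges belong to $J$. Two hyperplanes $H,K$ are well-separated relative to $\mathscr C$ if there is $L\ge 0$ such that $\sum_{i=1}^n\mathrm{thick}(J_i)\le L$ for every finite collection $\{J_1,\dots,J_n\}$ of (distinct) hyperplanes that are transverse to both $H$ and $K$ and among which there is no facing triple. Let $g\in G$. An axis of $g$ in $X$ is a bi-infinite geodesic of $(X,d)$ on which $g$ acts as a non-trivial translation. The element $g$ skewers a pair of hyperplanes $J_1,J_2$ if these delimit sectors $S_1\supsetneq S_2$, respectively, such that $g^nS_1\subsetneq S_2$ for some $n\in\mathbb Z$. Finally, $g$ is contracting in $(X,\delta)$ if, for every vertex $o$ of $X$, the map $\mathbb Z\to(X,\delta)$, $n\mapsto g^n o$, is a quasi-isometric embedding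 and the orbit $Y=\langle g\rangle\cdot o$ is contracting: there is $D\ge0$ such that, for every ball $B\subset(X,\delta)$ (open or closed) disjoint from $Y$, the set of all points of $Y$ that are nearest to some point of $B$ has diameter at most $D$. Theorem. Let $G$ be a group acting on a paraclique graph $X$ (by graph automorphisms), and let $\mathscr C$ be a coherent and $G$-invariant system of metrics on the cliques of $X$, with extended metric $\delta$. If $g\in G$ admits an axis in $X$ and skewers a pair of hyperplanes that are well-separated relative to $\mathscr C$, then $g$ is contracting in $(X,\delta)$. -/

import Mathlib

open scoped NNReal ENNReal

noncomputable section

namespace ParacliqueGraph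

variable {V : Type*}

/-- `x₀` is a gate of `x` in `Y`: it lies in `Y`, and for every `y ∈ Y` some geodesic (a walk of
minimal length) from `x` to `y` passes through `x₀`. -/
def IsGate (X : SimpleGraph V) (Y : Set V) (x x₀ : V) : Prop :=
  x₀ ∈ Y ∧ ∀ y ∈ Y, ∃ p : X.Walk x y, p.length = X.dist x y ∧ x₀ ∈ p.support

/-- The subgraph induced by `Y` is gated. -/
def IsGated (X : SimpleGraph V) (Y : Set V) : Prop :=
  ∀ x, ∃ x₀, IsGate X Y x x₀

open Classical in
/-- The projection on `Y`: a vertex is sent to its gate in `Y`. (Gates are unique in connected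
graphs; a vertex that has no gate is sent to itself, a junk value.) -/
def proj (X : SimpleGraph V) (Y : Set V) (x : V) : V :=
  if h : ∃ x₀, IsGate X Y x x₀ then h.choose else x

theorem isGate_proj {X : SimpleGraph V} {Y : Set V} (h : IsGated X Y) (x : V) :
    IsGate X Y x (proj X Y x) := by
  unfold proj
  rw [dif_pos (h x)]
  exact (h x).choose_spec

/-- A clique: (the vertex set of) a complete subgraph that is maximal with respect to inclusion. -/
abbrev Clique (X : SimpleGraph V) : Type _ :=
  {C : Set V // Maximal X.IsClique C}

/-- A connected graph all of whose cliques are gated. -/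
structure IsCliqueGated (X : SimpleGraph V) : Prop where
  connected : X.Connected
  gated : ∀ C : Clique X, IsGated X C.1

/-- `C` is parallel to `D`: the projection on `D` induces a bijection from `C` to `D`. -/
def Parallel {X : SimpleGraph V} (C D : Clique X) : Prop :=
  Set.BijOn (proj X D.1) C.1 D.1

/-- A clique-gated graph in which parallelism of cliques is transitive. -/
structure IsParaclique (X : SimpleGraph V) : Prop extends IsCliqueGated X where
  parallel_trans : ∀ C D E : Clique X, Parallel C D → Parallel D E → Parallel C E

/-! ### Hyperplanes and sectors -/

/-- The set of edges of the clique `C`. -/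
def Clique.edges {X : SimpleGraph V} (C : Clique X) : Set (Sym2 V) :=
  {e | e ∈ X.edgeSet ∧ ∀ v ∈ e, v ∈ C.1}

/-- A hyperplane: the union of all the edges of the cliques in a parallelism class. -/
def IsHyperplane (X : SimpleGraph V) (J : Set (Sym2 V)) : Prop :=
  ∃ C : Clique X, J = {e | ∃ D : Clique X, Parallel C D ∧ e ∈ D.edges}

/-- The hyperplanes of `X`, as sets of edges. -/
abbrev Hyperplane (X : SimpleGraph V) : Type _ :=
  {J : Set (Sym2 V) // IsHyperplane X J}

/-- `S` is a sector delimited by `J`: a connected component of the graph obtained from `X` by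
removing the edges in `J`. -/
def IsSector {X : SimpleGraph V} (J : Hyperplane X) (S : Set V) : Prop :=
  ∃ c : (X.deleteEdges J.1).ConnectedComponent, S = c.supp

/-- Every sector delimited by `J` intersects every sector delimited by `H`. -/
def Transverse {X : SimpleGraph V} (J H : Hyperplane X) : Prop :=
  ∀ S T : Set V, IsSector J S → IsSector H T → (S ∩ T).Nonempty

/-- The endpoints of the edges of `J`. -/
def Hyperplane.carrier {X : SimpleGraph V} (J : Hyperplane X) : Set V :=
  {v | ∃ e ∈ J.1, v ∈ e}

/-- `J` separates `H` and `K`: they lie in two distinct sectors delimited by `J`. -/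
def Separates {X : SimpleGraph V} (J H K : Hyperplane X) : Prop :=
  ∃ S T : Set V, IsSector J S ∧ IsSector J T ∧ S ≠ T ∧
    Hyperplane.carrier H ⊆ S ∧ Hyperplane.carrier K ⊆ T

/-- Three (distinct) pairwise non-transverse hyperplanes such that none separates the other two. -/
def IsFacingTriple {X : SimpleGraph V} (A B C : Hyperplane X) : Prop :=
  A ≠ B ∧ B ≠ C ∧ A ≠ C ∧
  ¬ Transverse A B ∧ ¬ Transverse B C ∧ ¬ Transverse A C ∧
  ¬ Separates A B C ∧ ¬ Separates B A C ∧ ¬ Separates C A B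

/-! ### Systems of metrics -/

/-- A system of metrics: a metric on each clique. -/
def SystemOfMetrics (X : SimpleGraph V) : Type _ :=
  ∀ C : Clique X, MetricSpace C.1

/-- The distance `δ_C(x, y)` of two vertices of the clique `C`. -/
def SystemOfMetrics.cliqueDist {X : SimpleGraph V} (𝒞 : SystemOfMetrics X) (C : Clique X)
    (x y : C.1) : ℝ :=
  (𝒞 C).dist x y

/-- The extended (pseudo-)metric `δ`: the infimum of the sums `∑ δ_{C_i}(v_i, v_{i+1})` over all
finite sequences of vertices `v_0 = x, v_1, …, v_n = y` and of cliques `C_0, …, C_{n-1}` such that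
`C_i` contains `v_i` and `v_{i+1}`. -/
def SystemOfMetrics.extDist {X : SimpleGraph V} (𝒞 : SystemOfMetrics X) (x y : V) : ℝ :=
  sInf {r : ℝ | ∃ (n : ℕ) (v : Fin (n + 1) → V) (C : Fin n → Clique X)
    (h₀ : ∀ i, v i.castSucc ∈ (C i).1) (h₁ : ∀ i, v i.succ ∈ (C i).1),
    v 0 = x ∧ v (Fin.last n) = y ∧
    r = ∑ i, 𝒞.cliqueDist (C i) ⟨v i.castSucc, h₀ i⟩ ⟨v i.succ, h₁ i⟩}

/-- The system is coherent: for parallel cliques `C` and `D`, the projection of `C` on `D` is an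
isometry. -/
def SystemOfMetrics.Coherent {X : SimpleGraph V} (𝒞 : SystemOfMetrics X) : Prop :=
  ∀ (C D : Clique X) (h : Parallel C D) (x y : C.1),
    𝒞.cliqueDist D ⟨proj X D.1 x, h.mapsTo x.2⟩ ⟨proj X D.1 y, h.mapsTo y.2⟩ = 𝒞.cliqueDist C x y

/-- The thickness of `J`: the diameter, possibly infinite, of the cliques in `J`. (All of them have
the same diameter when the system is coherent.) -/
def SystemOfMetrics.thickness {X : SimpleGraph V} (𝒞 : SystemOfMetrics X) (J : Hyperplane X) :
    ℝ≥0∞ :=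
  ⨆ (C : Clique X) (_ : C.edges ⊆ J.1) (x : C.1) (y : C.1), ENNReal.ofReal (𝒞.cliqueDist C x y)

/-- `H` and `K` are `L`-well-separated relative to `𝒞`. -/
def SystemOfMetrics.WellSeparatedWith {X : SimpleGraph V} (𝒞 : SystemOfMetrics X) (L : ℝ≥0)
    (H K : Hyperplane X) : Prop :=
  ∀ F : Finset (Hyperplane X),
    (∀ J ∈ F, Transverse J H ∧ Transverse J K) →
    (∀ A ∈ F, ∀ B ∈ F, ∀ C ∈ F, ¬ IsFacingTriple A B C) →
    ∑ J ∈ F, 𝒞.thickness J ≤ (L : ℝ≥0∞)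

/-- `H` and `K` are well-separated relative to `𝒞`. -/
def SystemOfMetrics.WellSeparated {X : SimpleGraph V} (𝒞 : SystemOfMetrics X)
    (H K : Hyperplane X) : Prop :=
  ∃ L : ℝ≥0, 𝒞.WellSeparatedWith L H K

/-! ### Group actions -/

section Action

variable {G : Type*} [Group G] [MulAction G V]

/-- `G` acts on the graph `X` by graph automorphisms. -/
def ActsOnGraph (G : Type*) [Group G] [MulAction G V] (X : SimpleGraph V) : Prop :=
  ∀ (g : G) (x y : V), X.Adj (g • x) (g • y) ↔ X.Adj x y

/-- The translate `gC` of a clique `C`. -/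
def Clique.translate {X : SimpleGraph V} (hG : ActsOnGraph G X) (g : G) (C : Clique X) :
    Clique X :=
  ⟨(fun x => g • x) '' C.1, by
    have key : ∀ (h : G) (S : Set V), X.IsClique S → X.IsClique ((fun x => h • x) '' S) := by
      rintro h S hS _ ⟨a, ha, rfl⟩ _ ⟨b, hb, rfl⟩ hab
      exact (hG h a b).2 (hS ha hb fun e => hab (by rw [e]))
    refine ⟨key g _ C.2.prop, fun T hT hCT => ?_⟩
    have h := C.2.le_of_ge (key g⁻¹ T hT) fun x hx =>
      ⟨g • x, hCT ⟨x, hx, rfl⟩, inv_smul_smul g x⟩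
    exact fun t ht => ⟨g⁻¹ • t, h ⟨t, ht, rfl⟩, smul_inv_smul g t⟩⟩

/-- The system is `G`-invariant: `δ_{gC}(gx, gy) = δ_C(x, y)`. -/
def SystemOfMetrics.Invariant {X : SimpleGraph V} (𝒞 : SystemOfMetrics X)
    (hG : ActsOnGraph G X) : Prop :=
  ∀ (g : G) (C : Clique X) (x y : C.1),
    𝒞.cliqueDist (C.translate hG g) ⟨g • x.1, x.1, x.2, rfl⟩ ⟨g • y.1, y.1, y.2, rfl⟩ =
      𝒞.cliqueDist C x y

/-- `g` admits an axis in `X`: a bi-infinite geodesic (for the graph metric) on which `g` acts as a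
non-trivial translation. -/
def HasAxis (X : SimpleGraph V) (g : G) : Prop :=
  ∃ γ : ℤ → V, (∀ i j : ℤ, (X.dist (γ i) (γ j) : ℤ) = |i - j|) ∧
    ∃ τ : ℤ, τ ≠ 0 ∧ ∀ i : ℤ, g • γ i = γ (i + τ)

/-- `g` skewers the pair `J₁, J₂`: they delimit two sectors `S₁ ⊋ S₂` such that `gⁿS₁ ⊊ S₂` for some
integer `n`. -/
def Skewers {X : SimpleGraph V} (g : G) (J₁ J₂ : Hyperplane X) : Prop :=
  ∃ S₁ S₂ : Set V, IsSector J₁ S₁ ∧ IsSector J₂ S₂ ∧ S₂ ⊂ S₁ ∧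
    ∃ n : ℤ, (fun x => g ^ n • x) '' S₁ ⊂ S₂

end Action

/-! ### Contracting elements -/

/-- The nearest-point projection of `x` on `Y` for the distance `δ`, as a set of points of `Y`. -/
def nearestPoints (δ : V → V → ℝ) (Y : Set V) (x : V) : Set V :=
  {p | p ∈ Y ∧ ∀ q ∈ Y, δ x p ≤ δ x q}

/-- `B` is a (closed or open) ball for the distance `δ`. -/
def IsBall (δ : V → V → ℝ) (B : Set V) : Prop :=
  ∃ (x : V) (r : ℝ), B = {y | δ x y ≤ r} ∨ B = {y | δ x y < r}

/-- `Y` is contracting: for some `D ≥ 0`, the projection on `Y` of every ball disjoint from `Y` has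
diameter at most `D`. -/
def IsContractingSet (δ : V → V → ℝ) (Y : Set V) : Prop :=
  ∃ D : ℝ, 0 ≤ D ∧ ∀ B : Set V, IsBall δ B → Disjoint B Y →
    ∀ x ∈ B, ∀ y ∈ B, ∀ p ∈ nearestPoints δ Y x, ∀ q ∈ nearestPoints δ Y y, δ p q ≤ D

/-- The orbit of `o` under `⟨g⟩` is quasi-isometrically embedded: `n ↦ gⁿ o` is a quasi-isometric
embedding of `ℤ`. -/
def OrbitQIEmbedded {G : Type*} [Group G] [MulAction G V] (δ : V → V → ℝ) (g : G) (o : V) : Prop :=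
  ∃ A B : ℝ, 1 ≤ A ∧ 0 ≤ B ∧ ∀ m n : ℤ,
    |(m : ℝ) - n| / A - B ≤ δ (g ^ m • o) (g ^ n • o) ∧
      δ (g ^ m • o) (g ^ n • o) ≤ A * |(m : ℝ) - n| + B

/-- `g` is contracting for the distance `δ`: for every basepoint `o`, the orbit `⟨g⟩ · o` is
quasi-isometrically embedded and contracting. -/
def IsContracting {G : Type*} [Group G] [MulAction G V] (δ : V → V → ℝ) (g : G) : Prop :=
  ∀ o : V, OrbitQIEmbedded δ g o ∧ IsContractingSet δ (Set.range fun n : ℤ => g ^ n • o)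

end ParacliqueGraph

end

noncomputable section

namespace ParacliqueGraph

variable {V : Type*} {X : SimpleGraph V}

/-! ### Projections on cliques -/

/-! The sectors of a hyperplane `J` are the fibres of the projection on any one of its cliques, so
`J` is encoded by the function `J.side`. A graph geodesic crosses each hyperplane at most once
(`side_eq_or_of_between`), so by coherence `δ` is the sum over all hyperplanes of the distances
between projections (`extDist_eq_sumDist`).

Let `x, c` lie outside `S₁` and `a, y` inside `S₂`. In δ(x,a) + δ(c,y) - δ(x,y) - δ(c,a), a
hyperplane contributes only if it separates both x from c and a from y. Such hyperplanes are
transverse to `J₁` and `J₂` and contain no facing triple, so well-separation bounds the expression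
by 2L (`sumDist_cross_le`).

The translates of `S₁` under powers of `g ^ n` are nested and exhaust the graph with empty
intersection, which gives each vertex an integer height (`exists_height`). The four-point inequality
then holds across every level. An orbit on the axis is evenly spaced for `δ`, and the inequality
forces distances between points of low and of high height to be nearly realised through this orbit.
Hence nearest points of x have about the height of x, and a ball missing the orbit has bounded
height variation up to the scale of the axis: this is contraction (`isContractingSet_of_cross`). -/

theorem IsGate.dist_eq (hX : X.Connected) {Y : Set V} {x x₀ y : V} (h : IsGate X Y x x₀)
    (hy : y ∈ Y) : X.dist x y = X.dist x x₀ + X.dist x₀ y := by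
  classical
  obtain ⟨p, hp, hx⟩ := h.2 y hy
  have h1 := SimpleGraph.dist_le (p.takeUntil x₀ hx)
  have h2 := SimpleGraph.dist_le (p.dropUntil x₀ hx)
  have h3 := congrArg SimpleGraph.Walk.length (p.take_spec hx)
  rw [SimpleGraph.Walk.length_append] at h3
  have h4 := hX.dist_triangle (u := x) (v := x₀) (w := y)
  omega

theorem exists_clique_of_adj {u v : V} (h : X.Adj u v) : ∃ C : Clique X, u ∈ C.1 ∧ v ∈ C.1 := by
  have huv : X.IsClique {u, v} := SimpleGraph.isClique_pair.2 fun _ => h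
  obtain ⟨C, hC, hm⟩ := zorn_subset_nonempty {s | X.IsClique s} (fun c hc hchain hne =>
    ⟨⋃₀ c, (Set.pairwise_sUnion hchain.directedOn).2 fun s hs => hc hs,
      fun s hs => Set.subset_sUnion_of_mem hs⟩) {u, v} huv
  exact ⟨⟨C, hm⟩, hC (by simp), hC (by simp)⟩

theorem proj_mem (hX : IsCliqueGated X) (C : Clique X) (x : V) : proj X C.1 x ∈ C.1 :=
  (isGate_proj (hX.gated C) x).1

theorem Clique.dist_eq_one (C : Clique X) {a b : V} (ha : a ∈ C.1) (hb : b ∈ C.1) (h : a ≠ b) :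
    X.dist a b = 1 :=
  SimpleGraph.dist_eq_one_iff_adj.2 (C.2.prop ha hb h)

theorem dist_of_ne_proj (hX : IsCliqueGated X) (C : Clique X) {x c : V} (hc : c ∈ C.1)
    (h : proj X C.1 x ≠ c) : X.dist x c = X.dist x (proj X C.1 x) + 1 := by
  rw [(isGate_proj (hX.gated C) x).dist_eq hX.connected hc,
    C.dist_eq_one (proj_mem hX C x) hc h]

/-- Distances from x to a clique take at most two values, and the smaller one is attained at the
gate only as soon as they differ. -/
theorem proj_eq_of_dist_lt (hX : IsCliqueGated X) (C : Clique X) {x c c' : V} (hc : c ∈ C.1)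
    (hc' : c' ∈ C.1) (h : X.dist x c < X.dist x c') : proj X C.1 x = c := by
  by_contra hne
  have h1 := dist_of_ne_proj hX C hc hne
  by_cases h2 : proj X C.1 x = c'
  · rw [h2] at h1; omega
  · have h3 := dist_of_ne_proj hX C hc' h2
    omega

theorem proj_of_mem (hX : IsCliqueGated X) (C : Clique X) {c : V} (hc : c ∈ C.1) :
    proj X C.1 c = c := by
  by_contra hne
  have h1 := dist_of_ne_proj hX C hc hne
  simp at h1

theorem proj_proj_of_ne (hX : IsCliqueGated X) (C D : Clique X) {a b : V} (ha : a ∈ D.1)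
    (hb : b ∈ D.1) (h : proj X C.1 a ≠ proj X C.1 b) : proj X D.1 (proj X C.1 a) = a := by
  -- The triangle inequalities make a and b equally far from their gates in C, so b is one step
  -- farther than a from the gate of a.
  have hab : a ≠ b := fun e => h (by rw [e])
  have h1 := dist_of_ne_proj hX C (proj_mem hX C b) h
  have h2 := dist_of_ne_proj hX C (proj_mem hX C a) h.symm
  have h3 := D.dist_eq_one ha hb hab
  have h4 := hX.connected.dist_triangle (u := a) (v := b) (w := proj X C.1 b)
  have h5 := hX.connected.dist_triangle (u := b) (v := a) (w := proj X C.1 a)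
  rw [SimpleGraph.dist_comm] at h3
  have h6 := X.dist_comm (u := a) (v := b)
  refine proj_eq_of_dist_lt hX D ha hb ?_
  rw [X.dist_comm (v := a), X.dist_comm (v := b)]
  omega

/-- If the projection on `C` is not constant on `D`, then the projections between `C` and `D` are
inverse to each other on `D`. -/
theorem proj_proj (hX : IsCliqueGated X) (C D : Clique X) {a b c : V} (ha : a ∈ D.1)
    (hb : b ∈ D.1) (h : proj X C.1 a ≠ proj X C.1 b) (hc : c ∈ D.1) :
    proj X D.1 (proj X C.1 c) = c := by
  by_cases h1 : proj X C.1 c = proj X C.1 a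
  · exact proj_proj_of_ne hX C D hc hb (h1 ▸ h)
  · exact proj_proj_of_ne hX C D hc ha h1

/-- The working criterion for parallelism: one pair with distinct projections suffices, because the
two projections are then mutually inverse. It also supplies the symmetry that the definition does
not display. -/
theorem parallel_of_proj_ne (hX : IsCliqueGated X) (C D : Clique X) {a b : V} (ha : a ∈ D.1)
    (hb : b ∈ D.1) (h : proj X C.1 a ≠ proj X C.1 b) : Parallel C D ∧ Parallel D C := by
  have h1 : ∀ c ∈ D.1, proj X D.1 (proj X C.1 c) = c := fun c => proj_proj hX C D ha hb h
  have h2 : ∀ c ∈ C.1, proj X C.1 (proj X D.1 c) = c := fun c =>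
    proj_proj hX D C (proj_mem hX C a) (proj_mem hX C b)
      (by rw [h1 a ha, h1 b hb]; exact fun e => h (by rw [e]))
  exact ⟨Set.InvOn.bijOn ⟨h2, h1⟩ (fun c _ => proj_mem hX D c) (fun c _ => proj_mem hX C c),
    Set.InvOn.bijOn ⟨h1, h2⟩ (fun c _ => proj_mem hX C c) (fun c _ => proj_mem hX D c)⟩

/-- A vertex is joined to its gate in `C` by a path on which the projection on `C` is constant. -/
theorem reflTransGen_proj (hX : IsCliqueGated X) (C : Clique X) (x : V) :
    Relation.ReflTransGen (fun u v => X.Adj u v ∧ proj X C.1 u = proj X C.1 v) x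
      (proj X C.1 x) := by
  have key : ∀ n x, X.dist x (proj X C.1 x) = n →
      Relation.ReflTransGen (fun u v => X.Adj u v ∧ proj X C.1 u = proj X C.1 v) x
        (proj X C.1 x) := by
    intro n
    induction n with
    | zero =>
      intro x hx
      rw [← (hX.connected.dist_eq_zero_iff).1 hx]
    | succ n ih =>
      intro x hx
      obtain ⟨z, hadj, hz⟩ : ∃ z, X.Adj x z ∧ X.dist z (proj X C.1 x) ≤ n := by
        generalize proj X C.1 x = c at hx
        obtain ⟨p, hp⟩ := hX.connected.exists_walk_length_eq_dist x c
        cases p with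
        | nil => simp at hx
        | cons hadj q =>
          rw [SimpleGraph.Walk.length_cons] at hp
          exact ⟨_, hadj, (SimpleGraph.dist_le q).trans (by omega)⟩
      have h1 := SimpleGraph.dist_eq_one_iff_adj.2 hadj
      have h2 : proj X C.1 z = proj X C.1 x := by
        by_contra hne
        have h3 := dist_of_ne_proj hX C (proj_mem hX C x) hne
        have h4 := dist_of_ne_proj hX C (proj_mem hX C z) (Ne.symm hne)
        have h5 := hX.connected.dist_triangle (u := x) (v := z) (w := proj X C.1 z)
        omega
      have h3 := hX.connected.dist_triangle (u := x) (v := z) (w := proj X C.1 x)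
      have h4 := ih z (by rw [h2]; omega)
      rw [h2] at h4
      exact h4.head ⟨hadj, h2.symm⟩
  exact key _ x rfl

/-- The projections on parallel cliques have the same fibres. -/
theorem proj_eq_of_parallel (hX : IsParaclique X) {C D : Clique X} (hDC : Parallel D C) {x y : V}
    (h : proj X C.1 x = proj X C.1 y) : proj X D.1 x = proj X D.1 y := by
  have hX' := hX.toIsCliqueGated
  have key : ∀ x, proj X D.1 x = proj X D.1 (proj X C.1 x) := by
    intro x
    have hp := reflTransGen_proj hX' C x
    generalize proj X C.1 x = c at hp
    induction hp with
    | refl => rfl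
    | @tail u v _ huv ih =>
      rw [ih]
      -- A clique through an edge that changes the projection on D is parallel to D, hence to C; the
      -- projection on C would then be injective on that edge, although it is constant along the
      -- path.
      by_contra hne
      obtain ⟨E, hu, hv⟩ := exists_clique_of_adj huv.1
      have hEC := hX.parallel_trans _ _ _ (parallel_of_proj_ne hX' D E hu hv hne).2 hDC
      exact huv.1.ne (hEC.injOn hu hv huv.2)
  rw [key x, h, ← key y]

/-! ### Hyperplanes and sectors -/

/-- A clique whose parallelism class defines `J`. -/
def Hyperplane.clique (J : Hyperplane X) : Clique X := J.2.choose

theorem Hyperplane.eq_edges (J : Hyperplane X) :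
    J.1 = {e | ∃ D : Clique X, Parallel J.clique D ∧ e ∈ D.edges} := J.2.choose_spec

/-- The projection of `x` on a fixed clique of `J`: it determines the sector of `x`. -/
def Hyperplane.side (J : Hyperplane X) (x : V) : V := proj X J.clique.1 x

theorem mem_edges {C : Clique X} {u v : V} :
    s(u, v) ∈ C.edges ↔ X.Adj u v ∧ u ∈ C.1 ∧ v ∈ C.1 := by
  simp [Clique.edges]

theorem clique_edges_subset (hX : IsCliqueGated X) (J : Hyperplane X) : J.clique.edges ⊆ J.1 := by
  intro e he
  rw [J.eq_edges]
  refine ⟨J.clique, ?_, he⟩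
  exact (Set.bijOn_id _).congr fun x hx => (proj_of_mem hX _ hx).symm

/-- This replaces edge sets by `side`: by `parallel_of_proj_ne`, one edge with distinct projections
decides whether a clique containing it belongs to `J`. -/
theorem mem_hyperplane_iff (hX : IsCliqueGated X) (J : Hyperplane X) {u v : V}
    (huv : X.Adj u v) : s(u, v) ∈ J.1 ↔ J.side u ≠ J.side v := by
  constructor
  · intro h
    rw [J.eq_edges] at h
    obtain ⟨D, hD, he⟩ := h
    obtain ⟨-, hu, hv⟩ := mem_edges.1 he
    obtain ⟨a, ha, rfl⟩ := hD.surjOn hu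
    obtain ⟨b, hb, rfl⟩ := hD.surjOn hv
    have := (parallel_of_proj_ne hX D J.clique ha hb huv.ne).1
    exact fun e => huv.ne (this.injOn hu hv e)
  · intro h
    obtain ⟨D, hu, hv⟩ := exists_clique_of_adj huv
    rw [J.eq_edges]
    exact ⟨D, (parallel_of_proj_ne hX J.clique D hu hv h).1, mem_edges.2 ⟨huv, hu, hv⟩⟩

theorem Hyperplane.ext_of_parallel (hX : IsParaclique X) {J K : Hyperplane X}
    (h : Parallel J.clique K.clique) (h' : Parallel K.clique J.clique) : J = K := by
  apply Subtype.ext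
  rw [J.eq_edges, K.eq_edges]
  ext e
  exact ⟨fun ⟨D, hD, he⟩ => ⟨D, hX.parallel_trans _ _ _ h' hD, he⟩,
    fun ⟨D, hD, he⟩ => ⟨D, hX.parallel_trans _ _ _ h hD, he⟩⟩

/-- Two vertices of a clique are separated by at most one hyperplane. -/
theorem Hyperplane.eq_of_side_ne (hX : IsParaclique X) {J K : Hyperplane X} {D : Clique X}
    {u v u' v' : V} (hu : u ∈ D.1) (hv : v ∈ D.1) (hu' : u' ∈ D.1) (hv' : v' ∈ D.1)
    (hJ : J.side u ≠ J.side v) (hK : K.side u' ≠ K.side v') : J = K := by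
  have h1 := parallel_of_proj_ne hX.toIsCliqueGated _ D hu hv hJ
  have h2 := parallel_of_proj_ne hX.toIsCliqueGated _ D hu' hv' hK
  exact ext_of_parallel hX (hX.parallel_trans _ _ _ h1.1 h2.2) (hX.parallel_trans _ _ _ h2.1 h1.2)

/-- Edges outside `J` preserve `side`; conversely, the path from a vertex to its gate given by
`reflTransGen_proj` avoids `J`. -/
theorem Hyperplane.reachable_iff (hX : IsCliqueGated X) (J : Hyperplane X) (x y : V) :
    (X.deleteEdges J.1).Reachable x y ↔ J.side x = J.side y := by
  constructor
  · rintro ⟨p⟩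
    induction p with
    | nil => rfl
    | cons hadj p ih =>
      rw [SimpleGraph.deleteEdges_adj, mem_hyperplane_iff hX J hadj.1, not_not] at hadj
      exact hadj.2.trans ih
  · have key : ∀ x, (X.deleteEdges J.1).Reachable x (J.side x) := by
      intro x
      have hp := reflTransGen_proj hX J.clique x
      unfold side
      generalize proj X J.clique.1 x = c at hp
      induction hp with
      | refl => rfl
      | tail _ huv ih =>
        refine ih.trans (SimpleGraph.Adj.reachable ?_)
        rw [SimpleGraph.deleteEdges_adj, mem_hyperplane_iff hX J huv.1, not_not]
        exact huv
    intro h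
    exact (key x).trans (h ▸ (key y).symm)

theorem isSector_iff (hX : IsCliqueGated X) (J : Hyperplane X) (S : Set V) :
    IsSector J S ↔ ∃ x, S = {y | J.side y = J.side x} := by
  constructor
  · rintro ⟨c, rfl⟩
    induction c using SimpleGraph.ConnectedComponent.ind with
    | _ x =>
      refine ⟨x, Set.ext fun y => ?_⟩
      rw [SimpleGraph.ConnectedComponent.mem_supp_iff, SimpleGraph.ConnectedComponent.eq,
        J.reachable_iff hX, Set.mem_ofPred_eq]
  · rintro ⟨x, rfl⟩
    refine ⟨(X.deleteEdges J.1).connectedComponentMk x, Set.ext fun y => ?_⟩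
    rw [SimpleGraph.ConnectedComponent.mem_supp_iff, SimpleGraph.ConnectedComponent.eq,
      J.reachable_iff hX, Set.mem_ofPred_eq]

theorem IsSector.mem_iff (hX : IsCliqueGated X) {J : Hyperplane X} {S : Set V} (hS : IsSector J S)
    {x y : V} (hx : x ∈ S) : y ∈ S ↔ J.side y = J.side x := by
  obtain ⟨z, rfl⟩ := (isSector_iff hX J S).1 hS
  rw [Set.mem_ofPred_eq] at hx ⊢
  rw [hx]

/-! ### Geodesics -/

theorem exists_geodesic (hX : X.Connected) (x y : V) : ∃ p : ℕ → V, p 0 = x ∧ p (X.dist x y) = y ∧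
    ∀ i j, i ≤ j → j ≤ X.dist x y → X.dist (p i) (p j) + i = j := by
  obtain ⟨w, hw⟩ := hX.exists_walk_length_eq_dist x y
  have h0 : w.getVert 0 = x := w.getVert_zero
  have hn : w.getVert (X.dist x y) = y := by rw [← hw, w.getVert_length]
  have hle : ∀ i k, i + k ≤ X.dist x y → X.dist (w.getVert i) (w.getVert (i + k)) ≤ k := by
    intro i k
    induction k with
    | zero => simp
    | succ k ih =>
      intro hk
      have h1 := ih (by omega)
      have h2 := SimpleGraph.dist_eq_one_iff_adj.2
        (w.adj_getVert_succ (i := i + k) (by omega))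
      have h3 := hX.dist_triangle (u := w.getVert i) (v := w.getVert (i + k))
        (w := w.getVert (i + k + 1))
      rw [← add_assoc]
      omega
  -- The upper bounds on the three pieces of the walk add up to the distance of its endpoints, so
  -- each is an equality.
  refine ⟨w.getVert, h0, hn, fun i j hij hj => ?_⟩
  have h1 := hle 0 i (by omega)
  have h2 := hle i (j - i) (by omega)
  have h3 := hle j (X.dist x y - j) (by omega)
  rw [zero_add, h0] at h1
  rw [Nat.add_sub_cancel' hij] at h2
  rw [Nat.add_sub_cancel' hj, hn] at h3
  have h4 := hX.dist_triangle (u := x) (v := w.getVert i) (w := y)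
  have h5 := hX.dist_triangle (u := w.getVert i) (v := w.getVert j) (w := y)
  omega

theorem exists_crossing {α : Type*} (f : ℕ → α) {n : ℕ} (h : f 0 ≠ f n) :
    ∃ i < n, f i ≠ f (i + 1) := by
  by_contra! hc
  refine h ?_
  have : ∀ k ≤ n, f 0 = f k := by
    intro k
    induction k with
    | zero => simp
    | succ k ih => exact fun hk => (ih (by omega)).trans (hc k (by omega))
  exact this n le_rfl

/-- An edge of a geodesic from `x` to `y` that lies in a hyperplane separating `x` and `y`. -/
theorem exists_crossing_edge (hX : IsCliqueGated X) (J : Hyperplane X) {x y : V}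
    (h : J.side x ≠ J.side y) : ∃ u v, X.Adj u v ∧ J.side u ≠ J.side v ∧
      X.dist x y = X.dist x u + 1 + X.dist v y := by
  obtain ⟨p, h0, hn, hp⟩ := exists_geodesic hX.connected x y
  obtain ⟨i, hi, hc⟩ := exists_crossing (fun i => J.side (p i)) (n := X.dist x y)
    (by rwa [h0, hn])
  have h1 := hp 0 i (by omega) (by omega)
  have h2 := hp i (i + 1) (by omega) (by omega)
  have h3 := hp (i + 1) (X.dist x y) (by omega) (by omega)
  rw [h0] at h1
  rw [hn] at h3
  exact ⟨p i, p (i + 1), SimpleGraph.dist_eq_one_iff_adj.1 (by omega), hc, by omega⟩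

/-- A hyperplane cannot separate a vertex of a geodesic from both endpoints. -/
theorem side_eq_or_of_between (hX : IsParaclique X) (J : Hyperplane X) {x y z : V}
    (h : X.dist x z = X.dist x y + X.dist y z) : J.side y = J.side x ∨ J.side y = J.side z := by
  have hX' := hX.toIsCliqueGated
  have tri := fun u v w => hX'.connected.dist_triangle (u := u) (v := v) (w := w)
  by_contra! hc
  -- Both y and z are nearer to v than to u, so they have the same gate v in a clique containing u
  -- and v, and `J` cannot separate them.
  obtain ⟨u, v, huv, hne, hd⟩ := exists_crossing_edge hX' J hc.1.symm
  obtain ⟨D, hu, hv⟩ := exists_clique_of_adj huv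
  have h1 := tri x u z
  have h2 := tri v y z
  have h3 := tri x u y
  have h4 : proj X D.1 y = v := proj_eq_of_dist_lt hX' D hv hu (by
    rw [X.dist_comm (u := y), X.dist_comm (u := y)]; omega)
  have h5 : proj X D.1 z = v := proj_eq_of_dist_lt hX' D hv hu (by
    rw [X.dist_comm (u := z), X.dist_comm (u := z)]; omega)
  exact hc.2 (proj_eq_of_parallel hX (parallel_of_proj_ne hX' J.clique D hu hv hne).1
    (h4.trans h5.symm))

/-! ### Transversality -/

theorem Transverse.symm {J H : Hyperplane X} (h : Transverse J H) : Transverse H J :=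
  fun S T hS hT => Set.inter_comm S T ▸ h T S hT hS

theorem exists_clique_of_mem_carrier (hX : IsCliqueGated X) {J : Hyperplane X} {w : V}
    (hw : w ∈ J.carrier) :
    ∃ (D : Clique X) (u v : V), w ∈ D.1 ∧ u ∈ D.1 ∧ v ∈ D.1 ∧ J.side u ≠ J.side v := by
  obtain ⟨e, he, hwe⟩ := hw
  have he' := he
  rw [J.eq_edges] at he
  obtain ⟨D, -, heD⟩ := he
  induction e using Sym2.ind with
  | _ u v =>
    exact ⟨D, u, v, heD.2 w hwe, heD.2 u (by simp), heD.2 v (by simp),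
      (mem_hyperplane_iff hX J heD.1).1 he'⟩

/-- The hyperplane of a clique `D` separates the vertices of `D` as the projection on `D` does. -/
theorem side_proj (hX : IsParaclique X) {J : Hyperplane X} {D : Clique X} {u v : V}
    (hu : u ∈ D.1) (hv : v ∈ D.1) (h : J.side u ≠ J.side v) (x : V) :
    J.side (proj X D.1 x) = J.side x :=
  proj_eq_of_parallel hX (parallel_of_proj_ne hX.toIsCliqueGated J.clique D hu hv h).1
    (proj_of_mem hX.toIsCliqueGated D (proj_mem hX.toIsCliqueGated D x))

theorem exists_crossing_edge_between (hX : IsCliqueGated X) (J : Hyperplane X) {x y : V}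
    (h : J.side x ≠ J.side y) : ∃ u v, X.Adj u v ∧ J.side u ≠ J.side v ∧
      X.dist x y = X.dist x u + X.dist u y := by
  obtain ⟨u, v, huv, hne, hd⟩ := exists_crossing_edge hX J h
  have h1 := hX.connected.dist_triangle (u := x) (v := u) (w := y)
  have h2 := hX.connected.dist_triangle (u := u) (v := v) (w := y)
  have h3 := SimpleGraph.dist_eq_one_iff_adj.2 huv
  exact ⟨u, v, huv, hne, by omega⟩

/-- The gates of x in cliques of `J` through w and w' stay in the `J`-sector of x and are separated
by `H`. A geodesic between them remains in that sector and crosses `H`; at the crossing, a clique of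
`H` meets every sector of `H` without leaving the sector of x. -/
theorem transverse_of_side_ne (hX : IsParaclique X) {J H : Hyperplane X} (hne : J ≠ H) {w w' : V}
    (hw : w ∈ J.carrier) (hw' : w' ∈ J.carrier) (h : H.side w ≠ H.side w') : Transverse J H := by
  have hX' := hX.toIsCliqueGated
  obtain ⟨D, u, v, hwD, hu, hv, huv⟩ := exists_clique_of_mem_carrier hX' hw
  obtain ⟨D', u', v', hwD', hu', hv', huv'⟩ := exists_clique_of_mem_carrier hX' hw'
  intro S T hS hT
  obtain ⟨x, rfl⟩ := (isSector_iff hX' J S).1 hS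
  obtain ⟨y, rfl⟩ := (isSector_iff hX' H T).1 hT
  have h1 : H.side (proj X D.1 x) = H.side w := by
    by_contra hc
    exact hne (Hyperplane.eq_of_side_ne hX hu hv (proj_mem hX' D x) hwD huv hc)
  have h2 : H.side (proj X D'.1 x) = H.side w' := by
    by_contra hc
    exact hne (Hyperplane.eq_of_side_ne hX hu' hv' (proj_mem hX' D' x) hwD' huv' hc)
  obtain ⟨a, b, hab, hsab, hd⟩ := exists_crossing_edge_between hX' H
    (x := proj X D.1 x) (y := proj X D'.1 x) (by rwa [h1, h2])
  obtain ⟨E, haE, hbE⟩ := exists_clique_of_adj hab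
  refine ⟨proj X E.1 y, ?_, side_proj hX haE hbE hsab y⟩
  have h3 : J.side a = J.side x := by
    have := side_eq_or_of_between hX J hd
    rw [side_proj hX hu hv huv, side_proj hX hu' hv' huv'] at this
    exact this.elim id id
  rw [Set.mem_ofPred_eq, ← h3]
  by_contra hc
  exact hne (Hyperplane.eq_of_side_ne hX (proj_mem hX' E y) haE haE hbE hc hsab)

theorem mem_carrier_of_adj (hX : IsCliqueGated X) {J : Hyperplane X} {u v : V} (huv : X.Adj u v)
    (h : J.side u ≠ J.side v) : u ∈ J.carrier :=
  ⟨s(u, v), (mem_hyperplane_iff hX J huv).2 h, by simp⟩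

/-- A hyperplane that separates two vertices of a sector delimited by `H` and two vertices outside
this sector is transverse to `H`. -/
theorem transverse_of_crossing (hX : IsParaclique X) {J H : Hyperplane X} {S : Set V}
    (hS : IsSector H S) {u v u' v' : V} (hu : u ∈ S) (hv : v ∈ S) (hu' : u' ∉ S) (hv' : v' ∉ S)
    (h : J.side u ≠ J.side v) (h' : J.side u' ≠ J.side v') : Transverse J H := by
  have hX' := hX.toIsCliqueGated
  rw [hS.mem_iff hX' hu] at hv hu' hv'
  have hne : J ≠ H := by
    rintro rfl
    exact h hv.symm
  obtain ⟨a, b, hab, hs, hd⟩ := exists_crossing_edge_between hX' J h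
  obtain ⟨a', b', hab', hs', hd'⟩ := exists_crossing_edge_between hX' J h'
  refine transverse_of_side_ne hX hne (mem_carrier_of_adj hX' hab hs)
    (mem_carrier_of_adj hX' hab' hs') ?_
  have h1 : H.side a = H.side u := by
    rcases side_eq_or_of_between hX H hd with h | h
    · exact h
    · exact h.trans hv
  rw [h1]
  rcases side_eq_or_of_between hX H hd' with h | h <;> rw [h]
  · exact Ne.symm hu'
  · exact Ne.symm hv'

/-! ### Facing triples -/

/-- Since the geodesic crosses `B` only once, the crossings of `A` and `C` lie on different sides of
`B`. By `transverse_of_side_ne`, `B` cannot split the carrier of a hyperplane not transverse to it.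
-/
theorem separates_of_lt (hX : IsParaclique X) {A B C : Hyperplane X} {p : ℕ → V} {n : ℕ}
    (hp : ∀ i j, i ≤ j → j ≤ n → X.dist (p i) (p j) + i = j) {i j k : ℕ} (hij : i < j) (hjk : j < k)
    (hkn : k < n) (hA : A.side (p i) ≠ A.side (p (i + 1)))
    (hB : B.side (p j) ≠ B.side (p (j + 1))) (hC : C.side (p k) ≠ C.side (p (k + 1)))
    (hAB : ¬ Transverse A B) (hCB : ¬ Transverse C B) (hneA : A ≠ B) (hneC : C ≠ B) :
    Separates B A C := by
  have hX' := hX.toIsCliqueGated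
  have hadj : ∀ l < n, X.Adj (p l) (p (l + 1)) := fun l hl => by
    have := hp l (l + 1) (by omega) (by omega)
    exact SimpleGraph.dist_eq_one_iff_adj.1 (by omega)
  have h1 : B.side (p j) = B.side (p i) := by
    have h1 := hp i j (by omega) (by omega)
    have h2 := hp j (j + 1) (by omega) (by omega)
    have h3 := hp i (j + 1) (by omega) (by omega)
    exact (side_eq_or_of_between hX B (x := p i) (y := p j) (z := p (j + 1)) (by omega)).resolve_right
      hB
  have h2 : B.side (p (j + 1)) = B.side (p k) := by
    have h1 := hp j (j + 1) (by omega) (by omega)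
    have h2 := hp (j + 1) k (by omega) (by omega)
    have h3 := hp j k (by omega) (by omega)
    exact (side_eq_or_of_between hX B (x := p j) (y := p (j + 1)) (z := p k) (by omega)).resolve_left
      hB.symm
  refine ⟨_, _, (isSector_iff hX' B _).2 ⟨p i, rfl⟩, (isSector_iff hX' B _).2 ⟨p k, rfl⟩, ?_,
    fun w hw => ?_, fun w hw => ?_⟩
  · intro h
    have : p i ∈ {y | B.side y = B.side (p k)} := h ▸ (rfl : B.side (p i) = B.side (p i))
    exact hB (h1.trans (Eq.trans this h2.symm))
  · by_contra hc
    exact hAB (transverse_of_side_ne hX hneA hw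
      (mem_carrier_of_adj hX' (hadj i (by omega)) hA) hc)
  · by_contra hc
    exact hCB (transverse_of_side_ne hX hneC hw
      (mem_carrier_of_adj hX' (hadj k (by omega)) hC) hc)

theorem Separates.symm {J H K : Hyperplane X} (h : Separates J H K) : Separates J K H := by
  obtain ⟨S, T, hS, hT, hne, hH, hK⟩ := h
  exact ⟨T, S, hT, hS, hne.symm, hK, hH⟩

/-- Three hyperplanes separating two given vertices do not form a facing triple. -/
theorem not_isFacingTriple (hX : IsParaclique X) {A B C : Hyperplane X} {x y : V}
    (hA : A.side x ≠ A.side y) (hB : B.side x ≠ B.side y) (hC : C.side x ≠ C.side y) :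
    ¬ IsFacingTriple A B C := by
  rintro ⟨hAB, hBC, hAC, tAB, tBC, tAC, sA, sB, sC⟩
  have hX' := hX.toIsCliqueGated
  obtain ⟨p, h0, hn, hp⟩ := exists_geodesic hX'.connected x y
  have cross : ∀ J : Hyperplane X, J.side x ≠ J.side y →
      ∃ i < X.dist x y, J.side (p i) ≠ J.side (p (i + 1)) := fun J hJ =>
    exists_crossing (fun i => J.side (p i)) (by rwa [h0, hn])
  have inj : ∀ J K : Hyperplane X, ∀ i < X.dist x y, J ≠ K → J.side (p i) ≠ J.side (p (i + 1)) →
      K.side (p i) ≠ K.side (p (i + 1)) → False := by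
    intro J K i hi hne hJ hK
    have h1 := hp i (i + 1) (by omega) (by omega)
    have h2 : X.dist (p i) (p (i + 1)) = 1 := by omega
    obtain ⟨D, hu, hv⟩ := exists_clique_of_adj (SimpleGraph.dist_eq_one_iff_adj.1 h2)
    exact hne (Hyperplane.eq_of_side_ne hX hu hv hu hv hJ hK)
  obtain ⟨i, hi, hiA⟩ := cross A hA
  obtain ⟨j, hj, hjB⟩ := cross B hB
  obtain ⟨k, hk, hkC⟩ := cross C hC
  have hij : i ≠ j := by rintro rfl; exact inj A B i hi hAB hiA hjB
  have hjk : j ≠ k := by rintro rfl; exact inj B C j hj hBC hjB hkC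
  have hik : i ≠ k := by rintro rfl; exact inj A C i hi hAC hiA hkC
  have tBA : ¬ Transverse B A := fun h => tAB h.symm
  have tCB : ¬ Transverse C B := fun h => tBC h.symm
  have tCA : ¬ Transverse C A := fun h => tAC h.symm
  -- Whichever crossing comes in the middle belongs to a hyperplane separating the other two.
  rcases lt_or_gt_of_ne hij with h1 | h1 <;> rcases lt_or_gt_of_ne hjk with h2 | h2 <;>
    rcases lt_or_gt_of_ne hik with h3 | h3
  · exact sB (separates_of_lt hX hp h1 h2 hk hiA hjB hkC tAB tCB hAB hBC.symm)
  · omega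
  · exact sC (separates_of_lt hX hp h3 h2 hj hiA hkC hjB tAC tBC hAC hBC)
  · exact sA (separates_of_lt hX hp h3 h1 hj hkC hiA hjB tCA tBA hAC.symm hAB.symm).symm
  · exact sA (separates_of_lt hX hp h1 h3 hk hjB hiA hkC tBA tCA hAB.symm hAC.symm)
  · exact sC (separates_of_lt hX hp h2 h3 hi hjB hkC hiA tBC tAC hBC hAC).symm
  · omega
  · exact sB (separates_of_lt hX hp h2 h1 hi hkC hjB hiA tCB tAB hBC.symm hAB).symm

/-! ### The extended metric as a sum over hyperplanes -/

namespace SystemOfMetrics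

variable (𝒞 : SystemOfMetrics X)

theorem cliqueDist_self (C : Clique X) (x : C.1) : 𝒞.cliqueDist C x x = 0 :=
  letI := 𝒞 C; dist_self x

theorem cliqueDist_comm (C : Clique X) (x y : C.1) : 𝒞.cliqueDist C x y = 𝒞.cliqueDist C y x :=
  letI := 𝒞 C; dist_comm x y

theorem cliqueDist_triangle (C : Clique X) (x y z : C.1) :
    𝒞.cliqueDist C x z ≤ 𝒞.cliqueDist C x y + 𝒞.cliqueDist C y z :=
  letI := 𝒞 C; dist_triangle x y z

theorem cliqueDist_nonneg (C : Clique X) (x y : C.1) : 0 ≤ 𝒞.cliqueDist C x y :=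
  letI := 𝒞 C; dist_nonneg

theorem cliqueDist_pos (C : Clique X) {x y : C.1} (h : x ≠ y) : 0 < 𝒞.cliqueDist C x y :=
  letI := 𝒞 C; dist_pos.2 h

/-- The distance between the projections of `x` and `y` on a clique of `J`. -/
def sideDist (hX : IsCliqueGated X) (J : Hyperplane X) (x y : V) : ℝ :=
  𝒞.cliqueDist J.clique ⟨J.side x, proj_mem hX _ x⟩ ⟨J.side y, proj_mem hX _ y⟩

variable {𝒞} (hX : IsCliqueGated X) (J : Hyperplane X)

theorem sideDist_congr {x y x' y' : V} (h : J.side x = J.side x') (h' : J.side y = J.side y') :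
    𝒞.sideDist hX J x y = 𝒞.sideDist hX J x' y' := by
  unfold sideDist
  congr 2

theorem sideDist_self (x : V) : 𝒞.sideDist hX J x x = 0 := 𝒞.cliqueDist_self _ _

theorem sideDist_eq_zero {x y : V} (h : J.side x = J.side y) : 𝒞.sideDist hX J x y = 0 := by
  rw [sideDist_congr hX J h rfl, sideDist_self]

theorem sideDist_comm (x y : V) : 𝒞.sideDist hX J x y = 𝒞.sideDist hX J y x :=
  𝒞.cliqueDist_comm _ _ _

theorem sideDist_triangle (x y z : V) :
    𝒞.sideDist hX J x z ≤ 𝒞.sideDist hX J x y + 𝒞.sideDist hX J y z :=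
  𝒞.cliqueDist_triangle _ _ _ _

theorem sideDist_nonneg (x y : V) : 0 ≤ 𝒞.sideDist hX J x y := 𝒞.cliqueDist_nonneg _ _ _

theorem sideDist_pos {x y : V} (h : J.side x ≠ J.side y) : 0 < 𝒞.sideDist hX J x y :=
  𝒞.cliqueDist_pos _ fun e => h (congrArg Subtype.val e)

theorem ofReal_sideDist_le (x y : V) :
    ENNReal.ofReal (𝒞.sideDist hX J x y) ≤ 𝒞.thickness J :=
  le_iSup₂_of_le J.clique (clique_edges_subset hX J) (le_iSup₂_of_le _ _ le_rfl)

end SystemOfMetrics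

/-- A separating hyperplane contains one of the finitely many edges of a geodesic, and each edge
determines its hyperplane. -/
theorem finite_setOf_side_ne (hX : IsParaclique X) (x y : V) :
    {J : Hyperplane X | J.side x ≠ J.side y}.Finite := by
  obtain ⟨p, h0, hn, hp⟩ := exists_geodesic hX.connected x y
  refine ((Finset.range (X.dist x y)).finite_toSet.biUnion
    (t := fun i => {J : Hyperplane X | J.side (p i) ≠ J.side (p (i + 1))}) fun i hi => ?_).subset ?_
  · have h1 := hp i (i + 1) (by omega) (by simpa using hi)
    have h2 : X.dist (p i) (p (i + 1)) = 1 := by omega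
    obtain ⟨D, hu, hv⟩ := exists_clique_of_adj (SimpleGraph.dist_eq_one_iff_adj.1 h2)
    exact Set.Subsingleton.finite fun J hJ K hK =>
      Hyperplane.eq_of_side_ne hX hu hv hu hv hJ hK
  · intro J hJ
    obtain ⟨i, hi, hne⟩ := exists_crossing (fun i => J.side (p i)) (n := X.dist x y)
      (by rwa [h0, hn])
    exact Set.mem_biUnion (by simpa using hi) hne

namespace SystemOfMetrics

variable (𝒞 : SystemOfMetrics X)

/-- The sum over all hyperplanes `J` of the distances between the projections on cliques of `J`. -/
def sumDist (hX : IsCliqueGated X) (x y : V) : ℝ :=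
  ∑ᶠ J : Hyperplane X, 𝒞.sideDist hX J x y

variable {𝒞} (hX : IsParaclique X)
include hX

theorem support_sideDist_subset (x y : V) :
    (Function.support fun J : Hyperplane X => 𝒞.sideDist hX.toIsCliqueGated J x y) ⊆
      {J : Hyperplane X | J.side x ≠ J.side y} :=
  fun J hJ h => hJ (sideDist_eq_zero _ J h)

theorem finite_support_sideDist (x y : V) :
    (Function.support fun J : Hyperplane X => 𝒞.sideDist hX.toIsCliqueGated J x y).Finite :=
  (finite_setOf_side_ne hX x y).subset (support_sideDist_subset hX x y)

theorem sumDist_eq_sum {x y : V} {U : Finset (Hyperplane X)}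
    (hU : ∀ J : Hyperplane X, J.side x ≠ J.side y → J ∈ U) :
    𝒞.sumDist hX.toIsCliqueGated x y = ∑ J ∈ U, 𝒞.sideDist hX.toIsCliqueGated J x y :=
  finsum_eq_sum_of_support_subset _ fun J hJ => hU J (support_sideDist_subset hX x y hJ)

theorem sumDist_self (x : V) : 𝒞.sumDist hX.toIsCliqueGated x x = 0 := by
  simp [sumDist, sideDist_self]

theorem sumDist_comm (x y : V) :
    𝒞.sumDist hX.toIsCliqueGated x y = 𝒞.sumDist hX.toIsCliqueGated y x :=
  finsum_congr fun J => sideDist_comm _ J x y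

theorem sumDist_triangle (x y z : V) : 𝒞.sumDist hX.toIsCliqueGated x z ≤
    𝒞.sumDist hX.toIsCliqueGated x y + 𝒞.sumDist hX.toIsCliqueGated y z := by
  have h1 := finite_support_sideDist (𝒞 := 𝒞) hX x y
  have h2 := finite_support_sideDist (𝒞 := 𝒞) hX y z
  unfold sumDist
  rw [← finsum_add_distrib h1 h2]
  exact finsum_le_finsum' (finite_support_sideDist hX x z)
    ((h1.union h2).subset (Function.support_add _ _)) fun J => sideDist_triangle _ J x y z

theorem sumDist_nonneg (x y : V) : 0 ≤ 𝒞.sumDist hX.toIsCliqueGated x y :=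
  finsum_nonneg fun J => sideDist_nonneg _ J x y

/-- The metric is additive along the geodesics of the graph. -/
theorem sumDist_add {x y z : V} (h : X.dist x z = X.dist x y + X.dist y z) :
    𝒞.sumDist hX.toIsCliqueGated x z =
      𝒞.sumDist hX.toIsCliqueGated x y + 𝒞.sumDist hX.toIsCliqueGated y z := by
  unfold sumDist
  rw [← finsum_add_distrib (finite_support_sideDist hX x y) (finite_support_sideDist hX y z)]
  refine finsum_congr fun J => ?_
  rcases side_eq_or_of_between hX J h with h | h
  · rw [sideDist_eq_zero (x := x) (y := y) _ J h.symm, sideDist_congr _ J h.symm rfl, zero_add]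
  · rw [sideDist_eq_zero (x := y) (y := z) _ J h, sideDist_congr _ J rfl h.symm, add_zero]

/-- Only the hyperplane of `C` separates two vertices of `C`. Its chosen clique need not be `C`, and
coherence compensates for this. -/
theorem sumDist_eq_cliqueDist (hcoh : 𝒞.Coherent) (C : Clique X) (x y : C.1) :
    𝒞.sumDist hX.toIsCliqueGated x y = 𝒞.cliqueDist C x y := by
  have hX' := hX.toIsCliqueGated
  by_cases hxy : x = y
  · rw [hxy, sumDist_self hX, cliqueDist_self]
  let J : Hyperplane X := ⟨_, C, rfl⟩
  have hadj : X.Adj x.1 y.1 := C.2.prop x.2 y.2 fun e => hxy (Subtype.ext e)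
  have hJ : J.side x ≠ J.side y := by
    rw [← mem_hyperplane_iff hX' J hadj]
    refine ⟨C, ?_, mem_edges.2 ⟨hadj, x.2, y.2⟩⟩
    exact (Set.bijOn_id _).congr fun x hx => (proj_of_mem hX' _ hx).symm
  have hpar := (parallel_of_proj_ne hX' J.clique C x.2 y.2 hJ).2
  have h1 : 𝒞.sideDist hX' J x y = 𝒞.cliqueDist C x y := hcoh C J.clique hpar x y
  rw [← h1]
  refine finsum_eq_single _ J fun K hK => sideDist_eq_zero _ K ?_
  by_contra hne
  exact hK (Hyperplane.eq_of_side_ne hX x.2 y.2 x.2 y.2 hne hJ)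

theorem sumDist_pos {x y : V} (h : x ≠ y) : 0 < 𝒞.sumDist hX.toIsCliqueGated x y := by
  have hX' := hX.toIsCliqueGated
  obtain ⟨p, h0, hn, hp⟩ := exists_geodesic hX.connected x y
  have hd := hX.connected.pos_dist_of_ne h
  have h1 := hp 0 1 (by omega) (by omega)
  have h2 : X.Adj x (p 1) := SimpleGraph.dist_eq_one_iff_adj.1 (by rw [← h0]; omega)
  obtain ⟨C, hx, hy⟩ := exists_clique_of_adj h2
  let J : Hyperplane X := ⟨_, C, rfl⟩
  have hJ : J.side x ≠ J.side (p 1) := by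
    rw [← mem_hyperplane_iff hX' J h2]
    refine ⟨C, ?_, mem_edges.2 ⟨h2, hx, hy⟩⟩
    exact (Set.bijOn_id _).congr fun x hx => (proj_of_mem hX' _ hx).symm
  rw [sumDist_add hX (x := x) (y := p 1) (z := y) (by
    have := hp 1 (X.dist x y) (by omega) le_rfl
    rw [h0] at h1
    rw [hn] at this
    omega)]
  refine add_pos_of_pos_of_nonneg ?_ (sumDist_nonneg hX _ _)
  exact finsum_pos (fun K => sideDist_nonneg _ K _ _) ⟨J, sideDist_pos _ J hJ⟩
    (finite_support_sideDist hX _ _)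

/-- Chains cost at least the sum by the triangle inequality, and additivity along a graph geodesic
makes it a chain of exactly this cost. -/
theorem extDist_eq_sumDist (hcoh : 𝒞.Coherent) (x y : V) :
    𝒞.extDist x y = 𝒞.sumDist hX.toIsCliqueGated x y := by
  have hX' := hX.toIsCliqueGated
  refine IsLeast.csInf_eq ⟨?_, ?_⟩
  · obtain ⟨p, h0, hn, hp⟩ := exists_geodesic hX.connected x y
    have hadj : ∀ l < X.dist x y, X.Adj (p l) (p (l + 1)) := fun l hl => by
      have := hp l (l + 1) (by omega) (by omega)
      exact SimpleGraph.dist_eq_one_iff_adj.1 (by omega)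
    choose C hC₀ hC₁ using fun i : Fin (X.dist x y) => exists_clique_of_adj (hadj i i.2)
    refine ⟨X.dist x y, fun i => p i, C, hC₀, hC₁, h0, hn, ?_⟩
    have hsum : ∀ k ≤ X.dist x y, 𝒞.sumDist hX' x (p k) =
        ∑ i ∈ Finset.range k, 𝒞.sumDist hX' (p i) (p (i + 1)) := by
      intro k
      induction k with
      | zero => simp [h0, sumDist_self hX]
      | succ k ih =>
        intro hk
        rw [Finset.sum_range_succ, ← ih (by omega)]
        have h1 := hp 0 k (by omega) (by omega)
        have h2 := hp 0 (k + 1) (by omega) (by omega)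
        have h3 := hp k (k + 1) (by omega) (by omega)
        rw [h0] at h1 h2
        exact sumDist_add hX (by omega)
    have h1 := hsum _ le_rfl
    rw [hn, Finset.sum_range] at h1
    rw [h1]
    exact Finset.sum_congr rfl fun i _ => sumDist_eq_cliqueDist hX hcoh (C i) ⟨_, hC₀ i⟩ ⟨_, hC₁ i⟩
  · rintro r ⟨n, v, C, h₀, h₁, rfl, rfl, rfl⟩
    have : ∀ (n : ℕ) (v : Fin (n + 1) → V), 𝒞.sumDist hX' (v 0) (v (Fin.last n)) ≤
        ∑ i : Fin n, 𝒞.sumDist hX' (v i.castSucc) (v i.succ) := by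
      intro n
      induction n with
      | zero => intro v; simp [sumDist_self hX]
      | succ n ih =>
        intro v
        rw [Fin.sum_univ_castSucc]
        have h1 := ih fun i => v i.castSucc
        have h2 := sumDist_triangle (𝒞 := 𝒞) hX (v 0) (v (Fin.last n).castSucc) (v (Fin.last n).succ)
        exact h2.trans (add_le_add_left h1 _)
    refine (this n v).trans_eq (Finset.sum_congr rfl fun i _ => ?_)
    exact sumDist_eq_cliqueDist hX hcoh (C i) ⟨_, h₀ i⟩ ⟨_, h₁ i⟩

/-- Vertices far away on both sides of a well-separated pair satisfy an almost equality of
four-point sums. -/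
theorem sumDist_cross_le {L : ℝ≥0} {J₁ J₂ : Hyperplane X} (hL : 𝒞.WellSeparatedWith L J₁ J₂)
    {S₁ S₂ : Set V} (hS₁ : IsSector J₁ S₁) (hS₂ : IsSector J₂ S₂) (hS : S₂ ⊆ S₁) {x c a y : V}
    (hx : x ∉ S₁) (hc : c ∉ S₁) (ha : a ∈ S₂) (hy : y ∈ S₂) :
    𝒞.sumDist hX.toIsCliqueGated x a + 𝒞.sumDist hX.toIsCliqueGated c y ≤
      𝒞.sumDist hX.toIsCliqueGated x y + 𝒞.sumDist hX.toIsCliqueGated c a + 2 * L := by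
  classical
  have hX' := hX.toIsCliqueGated
  let fin := fun u v => (finite_setOf_side_ne hX u v).toFinset
  have hfin : ∀ (u v : V) (J : Hyperplane X), J ∈ fin u v ↔ J.side u ≠ J.side v := by simp [fin]
  let U := fin x a ∪ fin c y ∪ fin x y ∪ fin c a
  rw [sumDist_eq_sum hX (U := U) (by simp +contextual [U, hfin]),
    sumDist_eq_sum hX (U := U) (by simp +contextual [U, hfin]),
    sumDist_eq_sum hX (U := U) (by simp +contextual [U, hfin]),
    sumDist_eq_sum hX (U := U) (by simp +contextual [U, hfin])]
  -- For a hyperplane outside `F` the two sides of the four-point inequality agree. Inside `F`, each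
  -- of the two distances on the left costs an extra distance from a to y, whence the factor 2.
  let F := U.filter fun J => J.side x ≠ J.side c ∧ J.side a ≠ J.side y
  have hF : ∀ J ∈ F, J.side x ≠ J.side c ∧ J.side a ≠ J.side y := fun J hJ =>
    (Finset.mem_filter.1 hJ).2
  have hFL : ∑ J ∈ F, 𝒞.sideDist hX' J a y ≤ L := by
    rw [← ENNReal.ofReal_le_coe, ENNReal.ofReal_sum_of_nonneg fun J _ => sideDist_nonneg hX' J a y]
    refine (Finset.sum_le_sum fun J _ => ofReal_sideDist_le hX' J a y).trans (hL F ?_ ?_)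
    · exact fun J hJ => ⟨transverse_of_crossing hX hS₁ (hS ha) (hS hy) hx hc (hF J hJ).2 (hF J hJ).1,
        transverse_of_crossing hX hS₂ ha hy (fun h => hx (hS h)) (fun h => hc (hS h))
          (hF J hJ).2 (hF J hJ).1⟩
    · exact fun A hA B hB C hC => not_isFacingTriple hX (hF A hA).1 (hF B hB).1 (hF C hC).1
  have hle : ∀ J ∈ U, 𝒞.sideDist hX' J x a + 𝒞.sideDist hX' J c y ≤
      𝒞.sideDist hX' J x y + 𝒞.sideDist hX' J c a +
        2 * (if J.side x ≠ J.side c ∧ J.side a ≠ J.side y then 𝒞.sideDist hX' J a y else 0) := by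
    intro J _
    split_ifs with h
    · have h1 := sideDist_triangle (𝒞 := 𝒞) hX' J x y a
      have h2 := sideDist_triangle (𝒞 := 𝒞) hX' J c a y
      rw [sideDist_comm hX' J y a] at h1
      linarith
    · rw [not_and_or, not_not, not_not] at h
      rcases h with h | h
      · rw [sideDist_congr hX' J h (rfl : J.side a = _), sideDist_congr hX' J h (rfl : J.side y = _)]
        linarith
      · rw [sideDist_congr hX' J (rfl : J.side x = _) h, sideDist_congr hX' J (rfl : J.side c = _) h]
        linarith
  have := Finset.sum_le_sum hle
  simp only [Finset.sum_add_distrib, ← Finset.mul_sum, ← Finset.sum_filter] at this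
  linarith

end SystemOfMetrics

/-! ### A criterion for contraction -/

section Criterion

variable {δ : V → V → ℝ} {ι : V → ℤ} {β : ℤ → V} {μ K : ℝ} {s : ℤ}

/-- Points of the line `β` are almost on the geodesics between points of smaller and larger
height. -/
theorem add_le_of_cross (hβ : ∀ m k, δ (β m) (β k) = μ * |(m : ℝ) - k|) (hι : ∀ m, ι (β m) = m + s)
    (hcross : ∀ i x c a y, ι x < i → ι c < i → i < ι a → i < ι y →
      δ x a + δ c y ≤ δ x y + δ c a + K) {x y : V} {m : ℤ} (hx : ι x + 2 ≤ m + s)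
    (hy : m + s + 2 ≤ ι y) : δ x (β m) + δ (β m) y ≤ δ x y + 2 * K := by
  have h0 := hι m
  have h1 := hι (m - 2)
  have h2 := hι (m + 2)
  -- Steps of 2 along `β` leave a level strictly between consecutive points. In the sum of `c1` and
  -- `c2` the distance from `β (m - 2)` to y cancels, and the distances along `β` balance, 4μ
  -- against 2μ + 2μ.
  have c1 := hcross (m + s - 1) x (β (m - 2)) (β m) y (by omega) (by omega) (by omega) (by omega)
  have c2 := hcross (m + s + 1) (β (m - 2)) (β m) (β (m + 2)) y (by omega) (by omega) (by omega)
    (by omega)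
  have e1 := hβ (m - 2) m
  have e2 := hβ m (m + 2)
  have e3 := hβ (m - 2) (m + 2)
  push_cast at e1 e2 e3
  rw [show (m : ℝ) - 2 - m = -2 by ring, abs_neg, abs_two] at e1
  rw [show (m : ℝ) - (m + 2) = -2 by ring, abs_neg, abs_two] at e2
  rw [show (m : ℝ) - 2 - (m + 2) = -4 by ring, abs_neg, abs_of_pos four_pos] at e3
  linarith

theorem isContractingSet_of_cross (hcomm : ∀ x y, δ x y = δ y x) (hnonneg : ∀ x y, 0 ≤ δ x y)
    (htri : ∀ x y z, δ x z ≤ δ x y + δ y z) (hμ : 0 ≤ μ) (hK : 0 ≤ K)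
    (hβ : ∀ m k, δ (β m) (β k) = μ * |(m : ℝ) - k|) (hι : ∀ m, ι (β m) = m + s)
    (hcross : ∀ i x c a y, ι x < i → ι c < i → i < ι a → i < ι y →
      δ x a + δ c y ≤ δ x y + δ c a + K) {Y : Set V} {R : ℝ} (hR : 0 ≤ R)
    (hY : ∀ p ∈ Y, ∃ m, δ p (β m) ≤ R) (hY' : ∀ m, ∃ p ∈ Y, δ p (β m) ≤ R) :
    IsContractingSet δ Y := by
  have mid : ∀ (x y : V) (m : ℤ), ι x + 2 ≤ m + s → m + s + 2 ≤ ι y →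
      δ x (β m) + δ (β m) y ≤ δ x y + 2 * K := fun x y m => add_le_of_cross hβ hι hcross
  -- If k had height far from that of x, a point of `β` at height ι x ± 2 would be markedly closer
  -- to x than `β k`. The threshold 4 leaves the margin of 2 that `mid` needs on both sides.
  have near : ∀ x, ∀ p ∈ nearestPoints δ Y x, ∀ k, δ p (β k) ≤ R →
      |μ * ((ι x : ℝ) - (k + s))| ≤ 2 * R + 2 * K + 4 * μ := by
    intro x p hp k hk
    have h1 : ∀ m, δ x (β k) ≤ δ x (β m) + 2 * R := by
      intro m
      obtain ⟨q, hq, hqm⟩ := hY' m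
      have := hp.2 q hq
      have := htri x p (β k)
      have := htri x (β m) q
      rw [hcomm (β m) q] at this
      linarith
    rw [abs_le]
    constructor
    · by_cases hc : ι x + 4 ≤ k + s
      · have h2 := mid x (β k) (ι x + 2 - s) (by omega) (by rw [hι]; omega)
        have h3 := h1 (ι x + 2 - s)
        have h4 := hβ (ι x + 2 - s) k
        have h5 : (ι x : ℝ) + 4 ≤ k + s := by exact_mod_cast hc
        push_cast at h4
        rw [abs_of_nonpos (by linarith)] at h4
        nlinarith
      · have h5 : (k : ℝ) + s ≤ ι x + 4 := by exact_mod_cast (by omega : k + s ≤ ι x + 4)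
        nlinarith
    · by_cases hc : k + s + 4 ≤ ι x
      · have h2 := mid (β k) x (ι x - 2 - s) (by rw [hι]; omega) (by omega)
        have h3 := h1 (ι x - 2 - s)
        have h4 := hβ k (ι x - 2 - s)
        have h5 : (k : ℝ) + s + 4 ≤ ι x := by exact_mod_cast hc
        push_cast at h4
        rw [abs_of_nonpos (by linarith)] at h4
        rw [hcomm (β k) x, hcomm _ x] at h2
        nlinarith
      · have h5 : (ι x : ℝ) ≤ k + s + 4 := by exact_mod_cast (by omega : ι x ≤ k + s + 4)
        nlinarith
  -- If the heights of z and x were far apart, going from z to x would mean reaching `β` near the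
  -- height of z and then following it, which costs more than reaching `Y`. Two uses of `mid` need
  -- the gap 6.
  have ball : ∀ z x, (∀ q ∈ Y, δ z x ≤ δ z q) →
      |μ * ((ι x : ℝ) - ι z)| ≤ R + 4 * K + 6 * μ := by
    intro z x hzx
    have h1 : ∀ m, δ z x ≤ δ z (β m) + R := by
      intro m
      obtain ⟨q, hq, hqm⟩ := hY' m
      have := hzx q hq
      have := htri z (β m) q
      rw [hcomm (β m) q] at this
      linarith
    rw [abs_le]
    constructor
    · by_cases hc : ι x + 6 ≤ ι z
      · have h2 := mid x z (ι x + 2 - s) (by omega) (by omega)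
        have h3 := mid (β (ι x + 2 - s)) z (ι z - 2 - s) (by rw [hι]; omega) (by omega)
        have h4 := h1 (ι z - 2 - s)
        have h5 := hβ (ι x + 2 - s) (ι z - 2 - s)
        have h6 : (ι x : ℝ) + 6 ≤ ι z := by exact_mod_cast hc
        push_cast at h5
        rw [abs_of_nonpos (by linarith)] at h5
        rw [hcomm x z] at h2
        rw [hcomm z (β _)] at h4
        have := hnonneg x (β (ι x + 2 - s))
        nlinarith
      · have h6 : (ι z : ℝ) ≤ ι x + 6 := by exact_mod_cast (by omega : ι z ≤ ι x + 6)
        nlinarith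
    · by_cases hc : ι z + 6 ≤ ι x
      · have h2 := mid z x (ι x - 2 - s) (by omega) (by omega)
        have h3 := mid z (β (ι x - 2 - s)) (ι z + 2 - s) (by omega) (by rw [hι]; omega)
        have h4 := h1 (ι z + 2 - s)
        have h5 := hβ (ι z + 2 - s) (ι x - 2 - s)
        have h6 : (ι z : ℝ) + 6 ≤ ι x := by exact_mod_cast hc
        push_cast at h5
        rw [abs_of_nonpos (by linarith)] at h5
        have := hnonneg (β (ι x - 2 - s)) x
        nlinarith
      · have h6 : (ι x : ℝ) ≤ ι z + 6 := by exact_mod_cast (by omega : ι x ≤ ι z + 6)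
        nlinarith
  refine ⟨2 * R + 2 * (2 * R + 2 * K + 4 * μ) + 2 * (R + 4 * K + 6 * μ), by positivity, ?_⟩
  rintro B ⟨z, r, hB⟩ hBY x hx y hy p hp q hq
  have hzB : ∀ x ∈ B, ∀ q ∈ Y, δ z x ≤ δ z q := by
    intro x hx q hq
    have hqB : q ∉ B := fun h => Set.disjoint_left.1 hBY h hq
    rcases hB with rfl | rfl
    · exact le_trans hx (not_le.1 hqB).le
    · exact le_trans (le_of_lt hx) (not_lt.1 hqB)
  obtain ⟨k, hk⟩ := hY p hp.1
  obtain ⟨l, hl⟩ := hY q hq.1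
  have n1 := abs_le.1 (near x p hp k hk)
  have n2 := abs_le.1 (near y q hq l hl)
  have b1 := abs_le.1 (ball z x (hzB x hx))
  have b2 := abs_le.1 (ball z y (hzB y hy))
  have t1 := htri p (β k) q
  have t2 := htri (β k) (β l) q
  rw [hcomm (β l) q] at t2
  -- Heights are compared along k, x, z, y, l: two uses of `near` and two of `ball`.
  have h1 : δ (β k) (β l) ≤ 2 * (2 * R + 2 * K + 4 * μ) + 2 * (R + 4 * K + 6 * μ) := by
    rw [hβ, ← abs_of_nonneg hμ, ← abs_mul, abs_of_nonneg hμ, abs_le]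
    constructor <;> linarith
  linarith

end Criterion

/-! ### The action of `g` -/

section Action

variable {G : Type*} [Group G] [MulAction G V]

theorem SystemOfMetrics.extDist_smul {hG : ActsOnGraph G X} {𝒞 : SystemOfMetrics X}
    (hinv : 𝒞.Invariant hG) (g : G) (x y : V) : 𝒞.extDist (g • x) (g • y) = 𝒞.extDist x y := by
  have key : ∀ (g : G) (x y : V), {r : ℝ | ∃ (n : ℕ) (v : Fin (n + 1) → V) (C : Fin n → Clique X)
      (h₀ : ∀ i, v i.castSucc ∈ (C i).1) (h₁ : ∀ i, v i.succ ∈ (C i).1),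
      v 0 = x ∧ v (Fin.last n) = y ∧
      r = ∑ i, 𝒞.cliqueDist (C i) ⟨v i.castSucc, h₀ i⟩ ⟨v i.succ, h₁ i⟩} ⊆
      {r : ℝ | ∃ (n : ℕ) (v : Fin (n + 1) → V) (C : Fin n → Clique X)
      (h₀ : ∀ i, v i.castSucc ∈ (C i).1) (h₁ : ∀ i, v i.succ ∈ (C i).1),
      v 0 = g • x ∧ v (Fin.last n) = g • y ∧
      r = ∑ i, 𝒞.cliqueDist (C i) ⟨v i.castSucc, h₀ i⟩ ⟨v i.succ, h₁ i⟩} := by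
    rintro g x y r ⟨n, v, C, h₀, h₁, rfl, rfl, rfl⟩
    exact ⟨n, fun i => g • v i, fun i => (C i).translate hG g, fun i => ⟨_, h₀ i, rfl⟩,
      fun i => ⟨_, h₁ i, rfl⟩, rfl, rfl, Finset.sum_congr rfl fun i _ =>
        (hinv g (C i) ⟨_, h₀ i⟩ ⟨_, h₁ i⟩).symm⟩
  unfold SystemOfMetrics.extDist
  congr 1
  refine Set.Subset.antisymm ?_ (key g x y)
  have := key g⁻¹ (g • x) (g • y)
  rwa [inv_smul_smul, inv_smul_smul] at this

theorem isContracting_of_cross {δ : V → V → ℝ} (hcomm : ∀ x y, δ x y = δ y x)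
    (hnonneg : ∀ x y, 0 ≤ δ x y) (htri : ∀ x y z, δ x z ≤ δ x y + δ y z)
    (hδ : ∀ (g : G) x y, δ (g • x) (g • y) = δ x y) {g : G} {b : V} {l K : ℝ} (hl : 0 < l)
    (hK : 0 ≤ K) (hb : ∀ m k : ℤ, δ (g ^ m • b) (g ^ k • b) = l * |(m : ℝ) - k|) {n : ℤ}
    (hn : n ≠ 0) {ι : V → ℤ} (hι : ∀ (m : ℤ) x, ι ((g ^ n) ^ m • x) = m + ι x)
    (hcross : ∀ i x c a y, ι x < i → ι c < i → i < ι a → i < ι y →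
      δ x a + δ c y ≤ δ x y + δ c a + K) : IsContracting δ g := by
  intro o
  constructor
  · refine ⟨max 1 (max l l⁻¹), 2 * δ o b, le_max_left _ _, by linarith [hnonneg o b],
      fun m k => ?_⟩
    have h1 := hb m k
    have h2 := htri (g ^ m • b) (g ^ m • o) (g ^ k • b)
    have h3 := htri (g ^ m • o) (g ^ k • o) (g ^ k • b)
    have h4 := htri (g ^ m • o) (g ^ m • b) (g ^ k • o)
    have h5 := htri (g ^ m • b) (g ^ k • b) (g ^ k • o)
    rw [hcomm (g ^ m • b) (g ^ m • o), hδ] at h2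
    rw [hδ, hcomm b o] at h5
    rw [hδ] at h3 h4
    have ha := abs_nonneg ((m : ℝ) - k)
    have hA : l⁻¹ ≤ max 1 (max l l⁻¹) := (le_max_right _ _).trans (le_max_right _ _)
    have hA' : l ≤ max 1 (max l l⁻¹) := (le_max_left _ _).trans (le_max_right _ _)
    have h6 : |(m : ℝ) - k| / max 1 (max l l⁻¹) ≤ l * |(m : ℝ) - k| := by
      rw [div_le_iff₀ (by positivity)]
      have : 1 ≤ l * max 1 (max l l⁻¹) := by
        exact (mul_inv_cancel₀ hl.ne').ge.trans (mul_le_mul_of_nonneg_left hA hl.le)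
      nlinarith
    have h7 := mul_le_mul_of_nonneg_right hA' ha
    constructor <;> linarith
  -- The line follows powers of `g ^ n`, so that each step raises the height by one; `R` absorbs the
  -- change of basepoint and the remainder of an exponent modulo n.
  · refine isContractingSet_of_cross (ι := ι) (β := fun m => (g ^ n) ^ m • b) (μ := l * |(n : ℝ)|)
      (s := ι b) (R := δ o b + l * |(n : ℝ)|) hcomm hnonneg htri (by positivity) hK
      (fun m k => ?_) (fun m => hι m b) hcross (add_nonneg (hnonneg _ _) (by positivity)) ?_ ?_
    · rw [← zpow_mul, ← zpow_mul, hb]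
      push_cast
      rw [← mul_sub, abs_mul, mul_assoc]
    · rintro _ ⟨k, rfl⟩
      refine ⟨k / n, ?_⟩
      have h1 : g ^ k = (g ^ n) ^ (k / n) * g ^ (k % n) := by
        rw [← zpow_mul, ← zpow_add, Int.mul_ediv_add_emod]
      have h2 := htri (g ^ (k % n) • o) (g ^ (k % n) • b) (g ^ (0 : ℤ) • b)
      rw [hδ, hb, zpow_zero, one_smul] at h2
      have h3 : |((k % n : ℤ) : ℝ) - (0 : ℤ)| ≤ |(n : ℝ)| := by
        rw [Int.cast_zero, sub_zero, ← Int.cast_abs, ← Int.cast_abs,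
          abs_of_nonneg (Int.emod_nonneg k hn)]
        exact_mod_cast (Int.emod_lt_abs k hn).le
      have h4 := mul_le_mul_of_nonneg_left h3 hl.le
      simp only [h1, mul_smul, hδ]
      linarith
    · intro m
      refine ⟨_, ⟨n * m, rfl⟩, ?_⟩
      simp only [zpow_mul, hδ]
      have : 0 ≤ l * |(n : ℝ)| := by positivity
      linarith

/-- A map that sends a sector `S₁` into a sector `S₂ ⊂ S₁` determines a height function, which
counts the translates of `S₁` that contain a given vertex. -/
theorem exists_height (hX : IsParaclique X) (hG : ActsOnGraph G X) {h : G} {J₁ J₂ : Hyperplane X}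
    {S₁ S₂ : Set V} (hS₁ : IsSector J₁ S₁) (hS₂ : IsSector J₂ S₂) (hS : S₂ ⊂ S₁)
    (hh : ∀ x ∈ S₁, h • x ∈ S₂) :
    ∃ ι : V → ℤ, ∀ (i : ℤ) x, h ^ (-i) • x ∈ S₁ ↔ i ≤ ι x := by
  have hX' := hX.toIsCliqueGated
  -- An edge from `S₂` to the complement of `S₁` would lie in both hyperplanes, forcing them and
  -- then the sectors to coincide. So crossing an edge changes the height by at most one, which
  -- makes heights finite.
  have noedge : ∀ u v, X.Adj u v → v ∈ S₂ → u ∈ S₁ := by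
    intro u v huv hv
    by_contra hu
    have h1 : J₁.side u ≠ J₁.side v := fun e => hu ((hS₁.mem_iff hX' (hS.1 hv)).2 e)
    have h2 : J₂.side u ≠ J₂.side v := fun e => hu (hS.1 ((hS₂.mem_iff hX' hv).2 e))
    obtain ⟨D, huD, hvD⟩ := exists_clique_of_adj huv
    have h3 := Hyperplane.eq_of_side_ne hX huD hvD huD hvD h1 h2
    subst h3
    exact hS.2 fun w hw => (hS₂.mem_iff hX' hv).2 ((hS₁.mem_iff hX' (hS.1 hv)).1 hw)
  have anti : ∀ (i j : ℤ) x, i ≤ j → h ^ (-j) • x ∈ S₁ → h ^ (-i) • x ∈ S₁ := by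
    intro i j x hij
    obtain ⟨k, rfl⟩ := Int.le.dest hij
    induction k with
    | zero => simp
    | succ k ih =>
      intro hx
      refine ih (by omega) (hS.1 ?_)
      have := hh _ hx
      rw [← mul_smul, ← zpow_one_add] at this
      convert this using 3
      push_cast
      ring
  have step : ∀ (i : ℤ) u v, X.Adj u v → h ^ (-(i + 1)) • v ∈ S₁ → h ^ (-i) • u ∈ S₁ := by
    intro i u v huv hv
    refine noedge _ (h ^ (-i) • v) ((hG _ _ _).2 huv) ?_
    have := hh _ hv
    rw [← mul_smul, ← zpow_one_add] at this
    convert this using 3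
    ring
  have walk : ∀ u v (p : X.Walk u v) (i : ℤ), h ^ (-(i + p.length)) • v ∈ S₁ →
      h ^ (-i) • u ∈ S₁ := by
    intro u v p
    induction p with
    | nil => simp
    | cons hadj q ih =>
      intro i hv
      refine step i _ _ hadj (ih (i + 1) ?_)
      convert hv using 3
      simp
      ring
  obtain ⟨v₀, hv₀, hv₀'⟩ := Set.exists_of_ssubset hS
  have key : ∀ x, ∃ i : ℤ, h ^ (-i) • x ∈ S₁ ∧ ∀ j : ℤ, h ^ (-j) • x ∈ S₁ → j ≤ i := by
    intro x
    obtain ⟨p⟩ := hX.connected.preconnected v₀ x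
    refine Int.exists_greatest_of_bdd ⟨1 + p.length, fun j hj => ?_⟩ ⟨-p.length, ?_⟩
    · by_contra hlt
      have h1 := hh _ (walk v₀ x p 1 (anti _ j x (by omega) hj))
      rw [← mul_smul, ← zpow_one_add] at h1
      simp at h1
      exact hv₀' h1
    · refine walk x v₀ p.reverse _ ?_
      simpa using hv₀
  choose ι hι hι' using key
  exact ⟨ι, fun i x => ⟨hι' x i, fun hi => anti _ _ _ hi (hι x)⟩⟩

theorem zpow_smul_axis {g : G} {γ : ℤ → V} {τ : ℤ} (h : ∀ i, g • γ i = γ (i + τ)) (m i : ℤ) :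
    g ^ m • γ i = γ (i + m * τ) := by
  induction m generalizing i with
  | zero => simp
  | succ m ih =>
    rw [zpow_add_one, mul_smul, h, ih]
    congr 1
    ring
  | pred m ih =>
    have h1 : g⁻¹ • γ i = γ (i - τ) := by
      rw [inv_smul_eq_iff, h, sub_add_cancel]
    rw [zpow_sub_one, mul_smul, h1, ih]
    congr 1
    ring

/-- The axis is a geodesic of the graph, so the metric is additive along it, and its segments
between consecutive orbit points are translates of one another. -/
theorem sumDist_axis (hX : IsParaclique X) {𝒞 : SystemOfMetrics X} {g : G}
    (hδ : ∀ x y, 𝒞.sumDist hX.toIsCliqueGated (g • x) (g • y) = 𝒞.sumDist hX.toIsCliqueGated x y)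
    {γ : ℤ → V} (hγ : ∀ i j : ℤ, (X.dist (γ i) (γ j) : ℤ) = |i - j|) {τ : ℤ}
    (h : ∀ i, g • γ i = γ (i + τ)) (m k : ℤ) :
    𝒞.sumDist hX.toIsCliqueGated (g ^ m • γ 0) (g ^ k • γ 0) =
      𝒞.sumDist hX.toIsCliqueGated (γ 0) (γ τ) * |(m : ℝ) - k| := by
  set δ := 𝒞.sumDist hX.toIsCliqueGated
  simp only [zpow_smul_axis h, zero_add]
  have step : ∀ m : ℤ, δ (γ (m * τ)) (γ ((m + 1) * τ)) = δ (γ 0) (γ τ) := by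
    intro m
    induction m with
    | zero => simp
    | succ m ih =>
      rw [← ih, ← hδ (γ (m * τ)), h, h]
      congr 2 <;> ring
    | pred m ih =>
      rw [← ih, ← hδ, h, h]
      congr 2 <;> ring
  have key : ∀ (m : ℤ) (j : ℕ), δ (γ (m * τ)) (γ ((m + j) * τ)) = δ (γ 0) (γ τ) * j := by
    intro m j
    induction j with
    | zero => simp [δ, SystemOfMetrics.sumDist_self hX]
    | succ j ih =>
      have h1 := SystemOfMetrics.sumDist_add (𝒞 := 𝒞) hX (x := γ (m * τ)) (y := γ ((m + j) * τ))
        (z := γ ((m + j + 1) * τ)) (by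
          zify
          rw [hγ, hγ, hγ, ← sub_mul, ← sub_mul, ← sub_mul, abs_mul, abs_mul, abs_mul, ← add_mul]
          congr 1
          rw [abs_of_nonpos (by omega), abs_of_nonpos (by omega), abs_of_nonpos (by omega)]
          ring)
      have h2 := step (m + j)
      push_cast
      rw [← add_assoc]
      refine h1.trans ?_
      rw [mul_add, mul_one, ← ih, ← h2]
  rcases le_total m k with hmk | hmk <;> obtain ⟨j, rfl⟩ := Int.le.dest hmk
  · rw [key]
    simp
  · rw [show δ (γ ((k + j) * τ)) (γ (k * τ)) = _ from SystemOfMetrics.sumDist_comm hX _ _]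
    refine (key k j).trans ?_
    simp

end Action

end ParacliqueGraph

end

/-! ### Contraction from a skewered well-separated pair -/

theorem mainTheorem2 {V : Type*} {G : Type*} [Group G] [MulAction G V] (X : SimpleGraph V)
    (hX : ParacliqueGraph.IsParaclique X) (hG : ParacliqueGraph.ActsOnGraph G X)
    (𝒞 : ParacliqueGraph.SystemOfMetrics X) (hcoh : 𝒞.Coherent) (hinv : 𝒞.Invariant hG)
    (g : G) (haxis : ParacliqueGraph.HasAxis X g)
    (J₁ J₂ : ParacliqueGraph.Hyperplane X) (hskew : ParacliqueGraph.Skewers g J₁ J₂)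
    (hsep : 𝒞.WellSeparated J₁ J₂) :
    ParacliqueGraph.IsContracting 𝒞.extDist g := by
  obtain ⟨γ, hγ, τ, hτ, hgγ⟩ := haxis
  obtain ⟨S₁, S₂, hS₁, hS₂, hS, n, hn⟩ := hskew
  obtain ⟨L, hL⟩ := hsep
  have hh : ∀ x ∈ S₁, g ^ n • x ∈ S₂ := fun x hx => hn.1 ⟨x, hx, rfl⟩
  have hn0 : n ≠ 0 := by
    rintro rfl
    exact hS.2 fun x hx => by simpa using hh x hx
  have hext : 𝒞.extDist = 𝒞.sumDist hX.toIsCliqueGated :=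
    funext₂ (ParacliqueGraph.SystemOfMetrics.extDist_eq_sumDist hX hcoh)
  have hδ := ParacliqueGraph.SystemOfMetrics.extDist_smul hinv
  rw [hext] at hδ ⊢
  obtain ⟨ι, hι⟩ := ParacliqueGraph.exists_height hX hG hS₁ hS₂ hS hh
  refine ParacliqueGraph.isContracting_of_cross (b := γ 0) (K := 2 * L) (ι := ι)
    (ParacliqueGraph.SystemOfMetrics.sumDist_comm hX)
    (ParacliqueGraph.SystemOfMetrics.sumDist_nonneg hX)
    (ParacliqueGraph.SystemOfMetrics.sumDist_triangle hX) hδ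
    (ParacliqueGraph.SystemOfMetrics.sumDist_pos hX (x := γ 0) (y := γ τ) ?_) (by positivity)
    (ParacliqueGraph.sumDist_axis hX (hδ g) hγ hgγ) hn0 ?_ ?_
  · intro e
    have := hγ 0 τ
    rw [e] at this
    simp at this
    exact hτ (abs_eq_zero.1 this.symm)
  · intro m x
    refine eq_of_forall_le_iff fun i => ?_
    rw [← hι, ← mul_smul, ← zpow_add, show -i + m = -(i - m) by ring, hι]
    omega
  -- Translating by `(g ^ n) ^ (-i)` moves heights below i outside `S₁` and heights above i into
  -- `S₂`, the latter because height at least i + 1 leaves one application of `g ^ n` to spare.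
  · intro i x c a y hx hc ha hy
    have low : ∀ x, ι x < i → (g ^ n) ^ (-i) • x ∉ S₁ := fun x hx h =>
      absurd ((hι i x).1 h) (by omega)
    have high : ∀ x, i < ι x → (g ^ n) ^ (-i) • x ∈ S₂ := by
      intro x hx
      have := hh _ ((hι (i + 1) x).2 (by omega))
      rw [← mul_smul, ← zpow_one_add] at this
      convert this using 3
      ring
    have := ParacliqueGraph.SystemOfMetrics.sumDist_cross_le hX hL hS₁ hS₂ hS.1
      (low x hx) (low c hc) (high a ha) (high y hy)
    simpa only [hδ] using this
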